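/- Let $H$ be a separable complex Hilbert space (finite- or infinite-dimensional) with $\dim H\ge 2$, let $T(H)$ be the Banach space of trace class operators on $H$ with the trace norm $\|X\|_1=\operatorname{tr}|X|$, and let $B(H\otimes H)$ be the Banach space of bounded operators on the Hilbert space tensor product $H\otimes H$ with the operator norm. Fix an orthonormal basis $(e_i)_i$ of $H$, and let $S\in B(H\otimes H)$ be the swap operator, $S(x\otimes y)=y\otimes x$. Let $\Phi:T(H)\to B(H\otimes H)$ be a linear map that is continuous with respect to these two norms. Then the following three conditions hold together: 1. (covariance under unitary evolution) $\Phi(UXU^*)=(U\otimes U)\,\Phi(X)\,(U^*\otimes U^*)$ for all $X\in T(H)$ and all unitary operators $U$ on $H$; 2. (invariance under permutation of the copies) $S\,\Phi(X)\,S=\Phi(X)$ for all $X\in T(H)$; 3. (consistency with classical broadcasting) for all $X\in T(H)$, $$(D\otimes D)\bigl(\Phi(D(X))\bigr)=\sum_i\langle Xe_i,e_i\rangle\, e_ie_i^*\otimes e_ie_i^*,$$ where $e_ie_i^*$ is the orthogonal projection onto $\mathbb{C}e_i$, $D(X)=\sum_i\langle Xe_i,e_i\rangle\, e_ie_i^*$,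 and $(D\otimes D)(Y)=\sum_{i,j}\langle Y(e_i\otimes e_j),e_i\otimes e_j\rangle\, e_ie_i^*\otimes e_je_j^*$ for $Y\in B(H\otimes H)$ (convergence in the strong operator topology); if and only if $$\Phi(X)=\tfrac12\bigl[S(I\otimes X)+S(X\otimes I)\bigr]\quad\text{for all } X\in T(H).$$ -/

import Mathlib

open scoped TensorProduct InnerProductSpace ENNReal

set_option linter.unusedSectionVars false

noncomputable section

namespace VirtualBroadcast

open InnerProductSpace

section TraceClass

variable {H : Type*} [NormedAddCommGroup H] [InnerProductSpace ℂ H] [CompleteSpace H]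

/-- The index set of a chosen orthonormal basis of `H`. -/
def StdIndex (H : Type*) [NormedAddCommGroup H] [InnerProductSpace ℂ H] [CompleteSpace H] :
    Set H :=
  (exists_hilbertBasis ℂ H).choose

/-- A chosen orthonormal basis of `H`. -/
def stdBasis (H : Type*) [NormedAddCommGroup H] [InnerProductSpace ℂ H] [CompleteSpace H] :
    HilbertBasis (StdIndex H) ℂ H :=
  (exists_hilbertBasis ℂ H).choose_spec.choose

/-- The trace norm `tr |X| = ∑ ⟨|X| e_i, e_i⟩` with values in `[0, ∞]`, where `|X| = (X* X)^{1/2}`.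
It does not depend on the orthonormal basis, see `traceENorm_eq`. -/
def traceENorm (X : H →L[ℂ] H) : ℝ≥0∞ :=
  ∑' i, ENNReal.ofReal (⟪stdBasis H i, CFC.abs X (stdBasis H i)⟫_ℂ).re

/-- The squared Hilbert-Schmidt norm of `A` computed in the orthonormal basis `b`. -/
def hsSq {ι : Type*} (b : HilbertBasis ι ℂ H) (A : H →L[ℂ] H) : ℝ≥0∞ :=
  ∑' i, ‖A (b i)‖ₑ ^ 2

lemma parseval {ι : Type*} (b : HilbertBasis ι ℂ H) (x : H) :
    ‖x‖ₑ ^ 2 = ∑' i, ‖⟪b i, x⟫_ℂ‖ₑ ^ 2 := by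
  have h := lp.hasSum_norm (p := 2) (by norm_num) (b.repr x)
  simp only [ENNReal.toReal_ofNat, LinearIsometryEquiv.norm_map, Real.rpow_ofNat,
    b.repr_apply_apply] at h
  have h2 := ENNReal.ofReal_tsum_of_nonneg (fun i => by positivity) h.summable
  rw [h.tsum_eq] at h2
  simpa [ENNReal.ofReal_pow] using h2

lemma hsSq_adjoint {ι κ : Type*} (b : HilbertBasis ι ℂ H) (c : HilbertBasis κ ℂ H)
    (A : H →L[ℂ] H) : hsSq b A = hsSq c (star A) := by
  unfold hsSq
  simp_rw [fun i => parseval c (A (b i)), fun j => parseval b (star A (c j))]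
  rw [ENNReal.tsum_comm]
  refine tsum_congr fun j => tsum_congr fun i => ?_
  rw [ContinuousLinearMap.star_eq_adjoint, ContinuousLinearMap.adjoint_inner_right,
    ← inner_conj_symm, ← ofReal_norm, RCLike.norm_conj, ofReal_norm]

lemma hsSq_basis {ι κ : Type*} (b : HilbertBasis ι ℂ H) (c : HilbertBasis κ ℂ H)
    (A : H →L[ℂ] H) : hsSq b A = hsSq c A := by
  rw [hsSq_adjoint b b, hsSq_adjoint b c, star_star]

lemma enorm_apply_le {C : H →L[ℂ] H} (hC : ‖C‖ ≤ 1) (x : H) : ‖C x‖ₑ ≤ ‖x‖ₑ := by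
  rw [← ofReal_norm, ← ofReal_norm]
  exact ENNReal.ofReal_le_ofReal (by simpa using C.le_of_opNorm_le hC x)

lemma norm_star_le_one {C : H →L[ℂ] H} (hC : ‖C‖ ≤ 1) : ‖star C‖ ≤ 1 := by
  rwa [norm_star]

lemma norm_unitary_le_one (U : unitary (H →L[ℂ] H)) : ‖(U : H →L[ℂ] H)‖ ≤ 1 := by
  have h1 : ‖star (U : H →L[ℂ] H) * (U : H →L[ℂ] H)‖ ≤ 1 := by
    rw [Unitary.coe_star_mul_self]
    exact ContinuousLinearMap.norm_id_le
  rw [CStarRing.norm_star_mul_self] at h1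
  nlinarith [norm_nonneg (U : H →L[ℂ] H)]

lemma hsSq_mul_le {ι : Type*} (b : HilbertBasis ι ℂ H) (A : H →L[ℂ] H) {C : H →L[ℂ] H}
    (hC : ‖C‖ ≤ 1) : hsSq b (A * C) ≤ hsSq b A := by
  rw [hsSq_adjoint b b, hsSq_adjoint b b A, star_mul]
  refine ENNReal.tsum_le_tsum fun i => ?_
  gcongr
  exact enorm_apply_le (norm_star_le_one hC) _

lemma inner_abs (X : H →L[ℂ] H) (x : H) :
    ENNReal.ofReal (⟪x, CFC.abs X x⟫_ℂ).re = ‖CFC.sqrt (CFC.abs X) x‖ₑ ^ 2 := by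
  have h1 : CFC.sqrt (CFC.abs X) * CFC.sqrt (CFC.abs X) = CFC.abs X :=
    CFC.sqrt_mul_sqrt_self _ (CFC.abs_nonneg X)
  have h2 : star (CFC.sqrt (CFC.abs X)) = CFC.sqrt (CFC.abs X) :=
    (CFC.sqrt_nonneg _).isSelfAdjoint.star_eq
  conv_lhs => rw [← h1]
  nth_rewrite 1 [← h2]
  rw [mul_apply_eq_comp, ContinuousLinearMap.star_eq_adjoint,
    ContinuousLinearMap.adjoint_inner_right, inner_self_eq_norm_sq_to_K]
  rw [← ofReal_norm, ← ENNReal.ofReal_pow (norm_nonneg _)]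
  congr 1
  norm_cast

/-- The trace norm may be computed in any orthonormal basis. -/
lemma traceENorm_eq {ι : Type*} (b : HilbertBasis ι ℂ H) (X : H →L[ℂ] H) :
    traceENorm X = ∑' i, ENNReal.ofReal (⟪b i, CFC.abs X (b i)⟫_ℂ).re := by
  unfold traceENorm
  simp_rw [inner_abs]
  exact hsSq_basis (stdBasis H) b _

lemma traceENorm_eq_hsSq {ι : Type*} (b : HilbertBasis ι ℂ H) (X : H →L[ℂ] H) :
    traceENorm X = hsSq b (CFC.sqrt (CFC.abs X)) := by
  rw [traceENorm_eq b]
  simp_rw [inner_abs]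
  rfl

lemma exists_contraction (A B : H →L[ℂ] H) (h : ∀ x, ‖B x‖ ≤ ‖A x‖) :
    ∃ V : H →L[ℂ] H, ‖V‖ ≤ 1 ∧ V * A = B := by
  let K : Submodule ℂ H := (LinearMap.range (A : H →ₗ[ℂ] H)).topologicalClosure
  have hmem : ∀ x, A x ∈ K := fun x => Submodule.le_topologicalClosure _ ⟨x, rfl⟩
  have : CompleteSpace K := (Submodule.isClosed_topologicalClosure _).completeSpace_coe
  let e : H →ₗ[ℂ] K := (A : H →ₗ[ℂ] H).codRestrict K hmem
  have he : DenseRange e := by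
    rw [DenseRange, Subtype.dense_iff]
    intro x hx
    have : (Subtype.val '' Set.range e : Set H) = LinearMap.range (A : H →ₗ[ℂ] H) := by
      ext y
      constructor
      · rintro ⟨_, ⟨z, rfl⟩, rfl⟩
        exact ⟨z, rfl⟩
      · rintro ⟨z, rfl⟩
        exact ⟨e z, ⟨z, rfl⟩, rfl⟩
    have h2 : closure (Subtype.val '' Set.range e : Set H) = K := by
      rw [this]; exact (Submodule.topologicalClosure_coe _).symm
    exact h2.ge hx
  have hb : ∀ x, ‖(B : H →ₗ[ℂ] H) x‖ ≤ 1 * ‖e x‖ := fun x => by simpa [e] using h x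
  refine ⟨(LinearMap.extendOfNorm (B : H →ₗ[ℂ] H) e) ∘L K.orthogonalProjectionOnto, ?_, ?_⟩
  · refine (ContinuousLinearMap.opNorm_comp_le _ _).trans ?_
    have h1 := LinearMap.opNorm_extendOfNorm_le (f := (B : H →ₗ[ℂ] H)) (e := e) he zero_le_one hb
    have h2 : ‖K.orthogonalProjectionOnto‖ ≤ 1 := K.orthogonalProjectionOnto_norm_le
    exact mul_le_one₀ h1 (norm_nonneg _) h2
  · ext x
    have h1 : K.orthogonalProjectionOnto (A x) = e x :=
      Submodule.orthogonalProjectionOnto_mem_subspace_eq_self (e x)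
    simp only [mul_apply_eq_comp, ContinuousLinearMap.comp_apply, h1]
    exact LinearMap.extendOfNorm_eq he ⟨1, hb⟩ x

lemma norm_abs_apply (X : H →L[ℂ] H) (x : H) : ‖CFC.abs X x‖ = ‖X x‖ := by
  have h1 : CFC.abs X * CFC.abs X = star X * X := CFC.abs_mul_abs X
  have h2 : star (CFC.abs X) = CFC.abs X := (CFC.abs_nonneg X).isSelfAdjoint.star_eq
  have h3 : ⟪CFC.abs X x, CFC.abs X x⟫_ℂ = ⟪X x, X x⟫_ℂ := by
    rw [← ContinuousLinearMap.adjoint_inner_right (CFC.abs X),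
      ← ContinuousLinearMap.adjoint_inner_right X, ← ContinuousLinearMap.star_eq_adjoint,
      ← ContinuousLinearMap.star_eq_adjoint, h2, ← mul_apply_eq_comp,
      ← mul_apply_eq_comp, h1]
  rw [inner_self_eq_norm_sq_to_K, inner_self_eq_norm_sq_to_K] at h3
  have h4 : ‖CFC.abs X x‖ ^ 2 = ‖X x‖ ^ 2 := by exact_mod_cast h3
  exact (sq_eq_sq₀ (norm_nonneg _) (norm_nonneg _)).mp h4

lemma exists_polar (X : H →L[ℂ] H) : ∃ V : H →L[ℂ] H, ‖V‖ ≤ 1 ∧ V * CFC.abs X = X :=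
  exists_contraction _ _ fun x => (norm_abs_apply X x).ge

lemma exists_polar' (X : H →L[ℂ] H) : ∃ W : H →L[ℂ] H, ‖W‖ ≤ 1 ∧ W * X = CFC.abs X :=
  exists_contraction _ _ fun x => (norm_abs_apply X x).le

lemma tsum_inner_le {ι : Type*} (b : HilbertBasis ι ℂ H) (X : H →L[ℂ] H) {B C : H →L[ℂ] H}
    (hB : ‖B‖ ≤ 1) (hC : ‖C‖ ≤ 1) :
    ∑' i, ‖⟪B (b i), X (C (b i))⟫_ℂ‖ₑ ≤ traceENorm X := by
  obtain ⟨V, hV, hVX⟩ := exists_polar X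
  set R := CFC.sqrt (CFC.abs X) with hR
  have h1 : R * R = CFC.abs X := CFC.sqrt_mul_sqrt_self _ (CFC.abs_nonneg X)
  have h2 : star R = R := (CFC.sqrt_nonneg _).isSelfAdjoint.star_eq
  have key : ∀ x y : H, ‖⟪x, X y⟫_ℂ‖ₑ ≤ (‖R (star V x)‖ₑ ^ 2 + ‖R y‖ₑ ^ 2) / 2 := by
    intro x y
    have h3 : ⟪x, X y⟫_ℂ = ⟪R (star V x), R y⟫_ℂ := by
      conv_lhs => rw [← hVX, ← h1]
      conv_rhs => rw [← h2]
      simp only [mul_apply_eq_comp, ContinuousLinearMap.star_eq_adjoint,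
        ContinuousLinearMap.adjoint_inner_left]
      rw [← ContinuousLinearMap.star_eq_adjoint, h2]
    rw [h3]
    have h4 : ‖⟪R (star V x), R y⟫_ℂ‖ ≤ (‖R (star V x)‖ ^ 2 + ‖R y‖ ^ 2) / 2 := by
      have := norm_inner_le_norm (𝕜 := ℂ) (R (star V x)) (R y)
      nlinarith [sq_nonneg (‖R (star V x)‖ - ‖R y‖)]
    have h5 := ENNReal.ofReal_le_ofReal h4
    rw [ENNReal.ofReal_div_of_pos two_pos, ENNReal.ofReal_add (by positivity) (by positivity),
      ENNReal.ofReal_pow (norm_nonneg _), ENNReal.ofReal_pow (norm_nonneg _)] at h5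
    simpa [ofReal_norm] using h5
  have hVB : ‖star V * B‖ ≤ 1 :=
    (norm_mul_le _ _).trans (mul_le_one₀ (by rwa [norm_star]) (norm_nonneg _) hB)
  have e1 : ∑' i, ‖R (star V (B (b i)))‖ₑ ^ 2 ≤ traceENorm X := by
    rw [traceENorm_eq_hsSq b]
    have h := hsSq_mul_le b R hVB
    simpa only [hsSq, mul_apply_eq_comp] using h
  have e2 : ∑' i, ‖R (C (b i))‖ₑ ^ 2 ≤ traceENorm X := by
    rw [traceENorm_eq_hsSq b]
    have h := hsSq_mul_le b R hC
    simpa only [hsSq, mul_apply_eq_comp] using h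
  calc ∑' i, ‖⟪B (b i), X (C (b i))⟫_ℂ‖ₑ
      ≤ ∑' i, (‖R (star V (B (b i)))‖ₑ ^ 2 + ‖R (C (b i))‖ₑ ^ 2) / 2 :=
        ENNReal.tsum_le_tsum fun i => key _ _
    _ = (∑' i, ‖R (star V (B (b i)))‖ₑ ^ 2 + ∑' i, ‖R (C (b i))‖ₑ ^ 2) / 2 := by
        simp_rw [div_eq_mul_inv]
        rw [ENNReal.tsum_mul_right, ENNReal.tsum_add]
    _ ≤ (traceENorm X + traceENorm X) / 2 := by gcongr
    _ = traceENorm X := by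
        rw [ENNReal.add_div, ENNReal.add_halves]

lemma traceENorm_le_of {ι : Type*} (b : HilbertBasis ι ℂ H) (Z : H →L[ℂ] H) {M : ℝ≥0∞}
    (h : ∀ W : H →L[ℂ] H, ‖W‖ ≤ 1 → ∑' i, ‖⟪W (b i), Z (b i)⟫_ℂ‖ₑ ≤ M) :
    traceENorm Z ≤ M := by
  obtain ⟨W, hW, hWZ⟩ := exists_polar' Z
  rw [traceENorm_eq b]
  refine le_trans (ENNReal.tsum_le_tsum fun i => ?_) (h (star W) (by rwa [norm_star]))
  rw [← hWZ, mul_apply_eq_comp, ContinuousLinearMap.star_eq_adjoint,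
    ContinuousLinearMap.adjoint_inner_left, ← ofReal_norm]
  exact ENNReal.ofReal_le_ofReal (Complex.re_le_norm _)

lemma traceENorm_add_le (X Y : H →L[ℂ] H) :
    traceENorm (X + Y) ≤ traceENorm X + traceENorm Y := by
  refine traceENorm_le_of (stdBasis H) _ fun W hW => ?_
  have hX := tsum_inner_le (stdBasis H) X hW (C := 1) ContinuousLinearMap.norm_id_le
  have hY := tsum_inner_le (stdBasis H) Y hW (C := 1) ContinuousLinearMap.norm_id_le
  refine le_trans ?_ (add_le_add hX hY)
  rw [← ENNReal.tsum_add]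
  refine ENNReal.tsum_le_tsum fun i => ?_
  simp only [add_apply, inner_add_right, one_apply_eq_self]
  exact enorm_add_le _ _

lemma traceENorm_smul (c : ℂ) (X : H →L[ℂ] H) :
    traceENorm (c • X) = ‖c‖ₑ * traceENorm X := by
  unfold traceENorm
  rw [← ENNReal.tsum_mul_left, CFC.abs_smul]
  refine tsum_congr fun i => ?_
  rw [smul_apply, inner_smul_right_eq_smul, Complex.smul_re, smul_eq_mul,
    ENNReal.ofReal_mul (norm_nonneg _), ofReal_norm]

lemma traceENorm_zero : traceENorm (0 : H →L[ℂ] H) = 0 := by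
  simp [traceENorm]

lemma eq_zero_of_traceENorm (X : H →L[ℂ] H) (h : traceENorm X = 0) : X = 0 := by
  rw [traceENorm_eq_hsSq (stdBasis H), hsSq, ENNReal.tsum_eq_zero] at h
  have h2 : CFC.sqrt (CFC.abs X) = 0 := by
    refine ContinuousLinearMap.ext_on (s := Set.range (stdBasis H)) ?_ ?_
    · rw [Submodule.dense_iff_topologicalClosure_eq_top]
      exact (stdBasis H).dense_span
    · rintro _ ⟨i, rfl⟩
      simpa using h i
  rw [CFC.sqrt_eq_zero_iff _ (CFC.abs_nonneg X)] at h2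
  exact CFC.abs_eq_zero_iff.mp h2

lemma traceENorm_mul_mul_le {A B : H →L[ℂ] H} (hA : ‖A‖ ≤ 1) (hB : ‖B‖ ≤ 1)
    (X : H →L[ℂ] H) : traceENorm (A * X * B) ≤ traceENorm X := by
  refine traceENorm_le_of (stdBasis H) _ fun W hW => ?_
  have hAW : ‖star A * W‖ ≤ 1 :=
    (norm_mul_le _ _).trans (mul_le_one₀ (by rwa [norm_star]) (norm_nonneg _) hW)
  refine le_trans (le_of_eq (tsum_congr fun i => ?_)) (tsum_inner_le (stdBasis H) X hAW hB)
  simp only [mul_apply_eq_comp, ContinuousLinearMap.star_eq_adjoint,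
    ContinuousLinearMap.adjoint_inner_left]

variable (H) in
/-- The trace class operators, as a subspace of `B(H)`. -/
def traceClassSubmodule : Submodule ℂ (H →L[ℂ] H) where
  carrier := {X | traceENorm X < ∞}
  zero_mem' := by simp [traceENorm_zero]
  add_mem' := fun {X Y} hX hY =>
    (traceENorm_add_le X Y).trans_lt (ENNReal.add_lt_top.mpr ⟨hX, hY⟩)
  smul_mem' := fun c X hX => by
    simp only [Set.mem_ofPred_eq, traceENorm_smul] at hX ⊢
    exact ENNReal.mul_lt_top enorm_lt_top hX

variable (H) in
/-- The space `T(H)` of trace class operators. It is a type of its own, so that it carries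
the trace norm and not the operator norm. -/
def TraceClass : Type _ := traceClassSubmodule H

namespace TraceClass

instance : AddCommGroup (TraceClass H) := inferInstanceAs (AddCommGroup (traceClassSubmodule H))

instance : Module ℂ (TraceClass H) := inferInstanceAs (Module ℂ (traceClassSubmodule H))

/-- The inclusion of `T(H)` in `B(H)`. -/
def toOp : TraceClass H →ₗ[ℂ] (H →L[ℂ] H) := (traceClassSubmodule H).subtype

/-- A bounded operator of finite trace norm as an element of `T(H)`. -/
def mk (X : H →L[ℂ] H) (hX : traceENorm X < ∞) : TraceClass H := ⟨X, hX⟩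

@[simp] lemma toOp_mk (X : H →L[ℂ] H) (hX : traceENorm X < ∞) : (mk X hX).toOp = X := rfl

lemma toOp_injective : Function.Injective (toOp : TraceClass H → H →L[ℂ] H) :=
  Subtype.val_injective

lemma traceENorm_lt_top (X : TraceClass H) : traceENorm X.toOp < ∞ := X.2

/-- The trace norm on `T(H)`. -/
instance : Norm (TraceClass H) := ⟨fun X => (traceENorm X.toOp).toReal⟩

lemma norm_def (X : TraceClass H) : ‖X‖ = (traceENorm X.toOp).toReal := rfl

lemma normedSpaceCore : NormedSpace.Core ℂ (TraceClass H) where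
  norm_nonneg X := ENNReal.toReal_nonneg
  norm_smul c X := by
    rw [norm_def, norm_def, map_smul, traceENorm_smul, ENNReal.toReal_mul, toReal_enorm]
  norm_triangle X Y := by
    rw [norm_def, norm_def, norm_def, map_add,
      ← ENNReal.toReal_add X.traceENorm_lt_top.ne Y.traceENorm_lt_top.ne]
    exact ENNReal.toReal_mono
      (ENNReal.add_ne_top.mpr ⟨X.traceENorm_lt_top.ne, Y.traceENorm_lt_top.ne⟩)
      (traceENorm_add_le _ _)
  norm_eq_zero_iff X := by
    rw [norm_def, ENNReal.toReal_eq_zero_iff, or_iff_left X.traceENorm_lt_top.ne]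
    constructor
    · intro h
      apply toOp_injective
      rw [eq_zero_of_traceENorm _ h, map_zero]
    · rintro rfl
      rw [map_zero, traceENorm_zero]

instance : NormedAddCommGroup (TraceClass H) := NormedAddCommGroup.ofCore normedSpaceCore

instance : NormedSpace ℂ (TraceClass H) := NormedSpace.ofCore normedSpaceCore

/-- The trace class operator `U X U*`, for a unitary `U`. -/
def conj (U : unitary (H →L[ℂ] H)) (X : TraceClass H) : TraceClass H :=
  mk ((U : H →L[ℂ] H) * X.toOp * star (U : H →L[ℂ] H)) <|
    (traceENorm_mul_mul_le (norm_unitary_le_one U)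
      (norm_star_le_one (norm_unitary_le_one U)) _).trans_lt X.traceENorm_lt_top

end TraceClass

end TraceClass

section Diagonal

variable {K : Type*} [NormedAddCommGroup K] [InnerProductSpace ℂ K] [CompleteSpace K]
  {ι : Type*} (b : HilbertBasis ι ℂ K)

lemma norm_diag_le (Y : K →L[ℂ] K) (i : ι) : ‖⟪b i, Y (b i)⟫_ℂ‖ ≤ ‖Y‖ := by
  refine (norm_inner_le_norm _ _).trans ?_
  have h := Y.le_opNorm (b i)
  simpa [b.orthonormal.1 i] using h

lemma memlp_diag (Y : K →L[ℂ] K) (x : K) :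
    Memℓp (fun i => ⟪b i, Y (b i)⟫_ℂ * ⟪b i, x⟫_ℂ) 2 := by
  have h : Summable fun i => ‖⟪b i, x⟫_ℂ‖ ^ 2 := by
    have h0 := (lp.hasSum_norm (p := 2) (by norm_num) (b.repr x)).summable
    simpa only [ENNReal.toReal_ofNat, Real.rpow_ofNat, b.repr_apply_apply] using h0
  refine memℓp_gen ?_
  simp only [ENNReal.toReal_ofNat, Real.rpow_ofNat]
  refine Summable.of_nonneg_of_le (fun i => by positivity) (fun i => ?_) (h.mul_left (‖Y‖ ^ 2))
  rw [norm_mul, mul_pow]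
  gcongr
  exact norm_diag_le b Y i

lemma hasSum_diag (Y : K →L[ℂ] K) (x : K) :
    HasSum (fun i => ⟪b i, Y (b i)⟫_ℂ • rankOne ℂ (b i) (b i) x)
      (b.repr.symm ⟨_, memlp_diag b Y x⟩) := by
  have h := b.hasSum_repr_symm ⟨_, memlp_diag b Y x⟩
  simpa [mul_smul] using h

/-- The diagonal operation `D(Y) = ∑ ⟨Y e_i, e_i⟩ e_i e_i*` with respect to an orthonormal basis.
The series converges in the strong operator topology, see `hasSum_diagonal`. -/
def diagonal (Y : K →L[ℂ] K) : K →L[ℂ] K :=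
  LinearMap.mkContinuous
    { toFun := fun x => ∑' i, ⟪b i, Y (b i)⟫_ℂ • rankOne ℂ (b i) (b i) x
      map_add' := fun x y => by
        rw [← (hasSum_diag b Y x).summable.tsum_add (hasSum_diag b Y y).summable]
        simp only [map_add, smul_add]
      map_smul' := fun c x => by
        simp only [map_smul, RingHom.id_apply]
        rw [← (hasSum_diag b Y x).summable.tsum_const_smul c]
        exact tsum_congr fun i => smul_comm _ _ _ }
    ‖Y‖ fun x => by
      change ‖∑' i, ⟪b i, Y (b i)⟫_ℂ • rankOne ℂ (b i) (b i) x‖ ≤ _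
      rw [(hasSum_diag b Y x).tsum_eq, LinearIsometryEquiv.norm_map]
      have h : ‖(‖Y‖ : ℂ) • b.repr x‖ = ‖Y‖ * ‖x‖ := by
        rw [norm_smul, LinearIsometryEquiv.norm_map]; simp
      rw [← h]
      refine lp.norm_mono (by norm_num) fun i => ?_
      rw [lp.coeFn_smul, Pi.smul_apply, norm_smul, b.repr_apply_apply]
      change ‖_ * _‖ ≤ _
      rw [norm_mul]
      gcongr
      simpa using norm_diag_le b Y i

lemma hasSum_diagonal (Y : K →L[ℂ] K) (x : K) :
    HasSum (fun i => ⟪b i, Y (b i)⟫_ℂ • rankOne ℂ (b i) (b i) x) (diagonal b Y x) :=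
  (hasSum_diag b Y x).summable.hasSum

lemma diagonal_apply_basis (Y : K →L[ℂ] K) (i : ι) :
    diagonal b Y (b i) = ⟪b i, Y (b i)⟫_ℂ • b i := by
  classical
  refine (hasSum_diagonal b Y (b i)).unique ?_
  have h := hasSum_ite_eq i (⟪b i, Y (b i)⟫_ℂ • b i)
  convert h using 2 with j
  rw [rankOne_apply, orthonormal_iff_ite.mp b.orthonormal j i]
  split_ifs with hij
  · subst hij; simp
  · simp

lemma traceENorm_diagonal_le (X : K →L[ℂ] K) : traceENorm (diagonal b X) ≤ traceENorm X := by
  refine traceENorm_le_of b _ fun W hW => ?_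
  have h := tsum_inner_le b X (B := 1) (C := 1) ContinuousLinearMap.norm_id_le
    ContinuousLinearMap.norm_id_le
  refine le_trans (ENNReal.tsum_le_tsum fun i => ?_) h
  rw [diagonal_apply_basis, inner_smul_right, enorm_mul]
  have h1 : ‖⟪W (b i), b i⟫_ℂ‖ₑ ≤ 1 := by
    rw [← ofReal_norm, ← ENNReal.ofReal_one]
    refine ENNReal.ofReal_le_ofReal ((norm_inner_le_norm _ _).trans ?_)
    have h2 := W.le_of_opNorm_le hW (b i)
    simpa [b.orthonormal.1 i] using h2
  simpa using mul_le_mul_right h1 (‖⟪b i, X (b i)⟫_ℂ‖ₑ)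

/-- The diagonal operation as a map of `T(K)` to itself. -/
def TraceClass.diagonal (X : TraceClass K) : TraceClass K :=
  TraceClass.mk (VirtualBroadcast.diagonal b X.toOp)
    ((traceENorm_diagonal_le b _).trans_lt X.traceENorm_lt_top)

end Diagonal

section Tensor

variable {H : Type*} [NormedAddCommGroup H] [InnerProductSpace ℂ H]

variable (H) in
/-- The Hilbert space tensor product `H ⊗ H`: the completion of the algebraic tensor product
for the inner product `⟨a ⊗ b, c ⊗ d⟩ = ⟨a, c⟩ ⟨b, d⟩`. -/
def HilbertTensor : Type _ := UniformSpace.Completion (H ⊗[ℂ] H)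

namespace HilbertTensor

instance : NormedAddCommGroup (HilbertTensor H) :=
  inferInstanceAs (NormedAddCommGroup (UniformSpace.Completion (H ⊗[ℂ] H)))

instance : InnerProductSpace ℂ (HilbertTensor H) :=
  inferInstanceAs (InnerProductSpace ℂ (UniformSpace.Completion (H ⊗[ℂ] H)))

instance : CompleteSpace (HilbertTensor H) :=
  inferInstanceAs (CompleteSpace (UniformSpace.Completion (H ⊗[ℂ] H)))

variable (H) in
/-- The isometric inclusion of the algebraic tensor product in the Hilbert space `H ⊗ H`. -/
def incl : H ⊗[ℂ] H →ₗᵢ[ℂ] HilbertTensor H :=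
  (UniformSpace.Completion.toComplₗᵢ : H ⊗[ℂ] H →ₗᵢ[ℂ] UniformSpace.Completion (H ⊗[ℂ] H))

lemma denseRange_incl : DenseRange (incl H) :=
  UniformSpace.Completion.denseRange_coe (α := H ⊗[ℂ] H)

end HilbertTensor

open HilbertTensor (incl)

/-- The elementary tensor `x ⊗ y` in the Hilbert space `H ⊗ H`. -/
def tmul (x y : H) : HilbertTensor H := incl H (x ⊗ₜ[ℂ] y)

/-- The extension of a bounded operator on the algebraic tensor product to `H ⊗ H`. -/
def extendOp (T : H ⊗[ℂ] H →L[ℂ] H ⊗[ℂ] H) : HilbertTensor H →L[ℂ] HilbertTensor H :=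
  T.completion

@[simp] lemma extendOp_incl (T : H ⊗[ℂ] H →L[ℂ] H ⊗[ℂ] H) (x : H ⊗[ℂ] H) :
    extendOp T (incl H x) = incl H (T x) :=
  T.completion_apply_coe x

/-- The operator `A ⊗ B` on `H ⊗ H`: the bounded operator with `(A ⊗ B)(x ⊗ y) = Ax ⊗ By`. -/
def tensorOp (A B : H →L[ℂ] H) : HilbertTensor H →L[ℂ] HilbertTensor H :=
  extendOp (TensorProduct.mapL A B)

@[simp] lemma tensorOp_tmul (A B : H →L[ℂ] H) (x y : H) :
    tensorOp A B (tmul x y) = tmul (A x) (B y) := by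
  simp [tensorOp, tmul]

variable (H) in
/-- The swap operator on `H ⊗ H`: the bounded operator with `S(x ⊗ y) = y ⊗ x`. -/
def swap : HilbertTensor H →L[ℂ] HilbertTensor H :=
  extendOp ((TensorProduct.commIsometry ℂ H H).toContinuousLinearEquiv :
    H ⊗[ℂ] H →L[ℂ] H ⊗[ℂ] H)

@[simp] lemma swap_tmul (x y : H) : swap H (tmul x y) = tmul y x := by
  simp [swap, tmul]

lemma inner_tmul (x y z w : H) : ⟪tmul x y, tmul z w⟫_ℂ = ⟪x, z⟫_ℂ * ⟪y, w⟫_ℂ := by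
  simp [tmul]

lemma continuous_tmul : Continuous fun p : H × H => tmul p.1 p.2 :=
  (incl H).continuous.comp TensorProduct.continuous_tmul

/-- `tmul` as a linear map in the second variable. -/
def tmulRight (x : H) : H →ₗ[ℂ] HilbertTensor H :=
  (incl H).toLinearMap ∘ₗ
    TensorProduct.mk ℂ H H x

/-- `tmul` as a linear map in the first variable. -/
def tmulLeft (y : H) : H →ₗ[ℂ] HilbertTensor H :=
  (incl H).toLinearMap ∘ₗ
    (TensorProduct.mk ℂ H H).flip y

lemma norm_mapL_le' (A B : H →L[ℂ] H) (x : H ⊗[ℂ] H) :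
    ‖TensorProduct.mapL A B x‖ ≤ ‖A‖ * ‖B‖ * ‖x‖ := by
  refine (ContinuousLinearMap.le_opNorm _ _).trans ?_
  gcongr
  exact TensorProduct.norm_mapL_le A B

lemma norm_tensorOp_le (A B : H →L[ℂ] H) : ‖tensorOp A B‖ ≤ ‖A‖ * ‖B‖ := by
  refine ContinuousLinearMap.opNorm_le_bound _ (by positivity) fun x => ?_
  induction x using HilbertTensor.denseRange_incl.induction_on with
  | hp => exact isClosed_le (by fun_prop) (by fun_prop)
  | ih x =>
    rw [tensorOp, extendOp_incl, LinearIsometry.norm_map, LinearIsometry.norm_map]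
    exact norm_mapL_le' A B x

variable {ι : Type*} (b : HilbertBasis ι ℂ H)

lemma orthonormal_tmul : Orthonormal ℂ fun p : ι × ι => tmul (b p.1) (b p.2) := by
  classical
  rw [orthonormal_iff_ite]
  rintro ⟨i, j⟩ ⟨k, l⟩
  rw [inner_tmul, orthonormal_iff_ite.mp b.orthonormal, orthonormal_iff_ite.mp b.orthonormal]
  by_cases h1 : i = k <;> by_cases h2 : j = l <;> simp [h1, h2]

lemma span_tmul_dense : ⊤ ≤ (Submodule.span ℂ
    (Set.range fun p : ι × ι => tmul (b p.1) (b p.2))).topologicalClosure := by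
  set M := (Submodule.span ℂ
    (Set.range fun p : ι × ι => tmul (b p.1) (b p.2))).topologicalClosure with hM
  have hMc : IsClosed (M : Set (HilbertTensor H)) := Submodule.isClosed_topologicalClosure _
  have dense_ind : ∀ f : H →ₗ[ℂ] HilbertTensor H, Continuous f → (∀ i, f (b i) ∈ M) →
      ∀ x, f x ∈ M := by
    intro f hf h x
    have h1 : (Submodule.span ℂ (Set.range b)).topologicalClosure ≤ M.comap f := by
      refine Submodule.topologicalClosure_minimal _ ?_ (hMc.preimage hf)
      rw [Submodule.span_le]
      rintro _ ⟨i, rfl⟩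
      exact h i
    rw [b.dense_span] at h1
    exact h1 trivial
  have hb : ∀ i j, tmul (b i) (b j) ∈ M := fun i j =>
    Submodule.le_topologicalClosure _ (Submodule.subset_span ⟨(i, j), rfl⟩)
  have h1 : ∀ i y, tmul (b i) y ∈ M := fun i =>
    dense_ind (tmulRight (b i)) (continuous_tmul.comp (by fun_prop : Continuous fun y => (b i, y)))
      (hb i)
  have h2 : ∀ x y, tmul x y ∈ M := fun x y =>
    dense_ind (tmulLeft y) (continuous_tmul.comp (by fun_prop : Continuous fun x => (x, y)))
      (fun i => h1 i y) x
  rintro z -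
  induction z using HilbertTensor.denseRange_incl.induction_on with
  | hp => exact hMc
  | ih z =>
    induction z using TensorProduct.induction_on with
    | zero => rw [map_zero]; exact M.zero_mem
    | tmul x y => exact h2 x y
    | add x y hx hy =>
      rw [map_add]
      exact M.add_mem hx hy

/-- The product orthonormal basis `e_i ⊗ e_j` of `H ⊗ H`. -/
def tensorBasis : HilbertBasis (ι × ι) ℂ (HilbertTensor H) :=
  HilbertBasis.mk (orthonormal_tmul b) (span_tmul_dense b)

@[simp] lemma tensorBasis_apply (i j : ι) : tensorBasis b (i, j) = tmul (b i) (b j) := by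
  simp [tensorBasis]

/-- The map `D ⊗ D` on `B(H ⊗ H)`, where `D` is the diagonal operation for the basis `b` of `H`.
It is the diagonal operation for the product basis `e_i ⊗ e_j`:
`(D ⊗ D)(Y) = ∑ ⟨Y (e_i ⊗ e_j), e_i ⊗ e_j⟩ e_i e_i* ⊗ e_j e_j*`,
and it satisfies `(D ⊗ D)(A ⊗ B) = D(A) ⊗ D(B)`, see `tensorDiagonal_tensorOp`. -/
def tensorDiagonal (Y : HilbertTensor H →L[ℂ] HilbertTensor H) :
    HilbertTensor H →L[ℂ] HilbertTensor H :=
  diagonal (tensorBasis b) Y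

lemma ext_tensorBasis {Y Z : HilbertTensor H →L[ℂ] HilbertTensor H}
    (h : ∀ i j, Y (tmul (b i) (b j)) = Z (tmul (b i) (b j))) : Y = Z := by
  refine ContinuousLinearMap.ext_on (s := Set.range (tensorBasis b)) ?_ ?_
  · rw [Submodule.dense_iff_topologicalClosure_eq_top]
    exact (tensorBasis b).dense_span
  · rintro _ ⟨⟨i, j⟩, rfl⟩
    simpa using h i j

lemma smul_tmul_smul (r s : ℂ) (x y : H) : tmul (r • x) (s • y) = (r * s) • tmul x y := by
  simp only [tmul, TensorProduct.smul_tmul_smul, map_smul]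

lemma tensorDiagonal_tensorOp [CompleteSpace H] (A B : H →L[ℂ] H) :
    tensorDiagonal b (tensorOp A B) = tensorOp (diagonal b A) (diagonal b B) := by
  refine ext_tensorBasis b fun i j => ?_
  have h := diagonal_apply_basis (tensorBasis b) (tensorOp A B) (i, j)
  rw [tensorBasis_apply, tensorOp_tmul, inner_tmul] at h
  rw [tensorDiagonal, h, tensorOp_tmul, diagonal_apply_basis, diagonal_apply_basis,
    smul_tmul_smul]

end Tensor

section Broadcast

variable {H : Type*} [NormedAddCommGroup H] [InnerProductSpace ℂ H] [CompleteSpace H]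
  {ι : Type*} (b : HilbertBasis ι ℂ H)

/-- Classical broadcasting `B_cl(X) = ∑ ⟨X e_i, e_i⟩ e_i e_i* ⊗ e_i e_i*` of a trace class
operator. The series converges in operator norm, see `hasSum_classicalBroadcast`. -/
def classicalBroadcast (X : TraceClass H) : HilbertTensor H →L[ℂ] HilbertTensor H :=
  ∑' i, ⟪b i, X.toOp (b i)⟫_ℂ • tensorOp (rankOne ℂ (b i) (b i)) (rankOne ℂ (b i) (b i))

lemma summable_norm_diag (X : TraceClass H) : Summable fun i => ‖⟪b i, X.toOp (b i)⟫_ℂ‖ := by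
  have h : ∑' i, ‖⟪b i, X.toOp (b i)⟫_ℂ‖ₑ < ∞ := by
    have h := tsum_inner_le b X.toOp (B := 1) (C := 1) ContinuousLinearMap.norm_id_le
      ContinuousLinearMap.norm_id_le
    simp only [one_apply_eq_self] at h
    exact h.trans_lt X.traceENorm_lt_top
  have h2 := ENNReal.summable_toReal h.ne
  simpa only [toReal_enorm] using h2

lemma norm_tensorOp_rankOne_le (i : ι) :
    ‖tensorOp (rankOne ℂ (b i) (b i)) (rankOne ℂ (b i) (b i))‖ ≤ 1 := by
  refine (norm_tensorOp_le _ _).trans ?_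
  simp [b.orthonormal.1 i]

lemma hasSum_classicalBroadcast (X : TraceClass H) :
    HasSum (fun i => ⟪b i, X.toOp (b i)⟫_ℂ •
      tensorOp (rankOne ℂ (b i) (b i)) (rankOne ℂ (b i) (b i))) (classicalBroadcast b X) := by
  have h : Summable (fun i => ⟪b i, X.toOp (b i)⟫_ℂ •
      tensorOp (rankOne ℂ (b i) (b i)) (rankOne ℂ (b i) (b i))) := by
    refine Summable.of_norm_bounded (summable_norm_diag b X) fun i => ?_
    rw [norm_smul]
    exact mul_le_of_le_one_right (norm_nonneg _) (norm_tensorOp_rankOne_le b i)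
  exact h.hasSum

/-- Covariance under unitary evolution: `Φ(U X U*) = (U ⊗ U) Φ(X) (U* ⊗ U*)`. -/
def IsUnitaryCovariant
    (Φ : TraceClass H →L[ℂ] (HilbertTensor H →L[ℂ] HilbertTensor H)) : Prop :=
  ∀ (U : unitary (H →L[ℂ] H)) (X : TraceClass H),
    Φ (X.conj U) = tensorOp (U : H →L[ℂ] H) (U : H →L[ℂ] H) * Φ X *
      tensorOp (star (U : H →L[ℂ] H)) (star (U : H →L[ℂ] H))

/-- Invariance under permutation of the copies: `S Φ(X) S = Φ(X)`. -/
def IsPermutationInvariant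
    (Φ : TraceClass H →L[ℂ] (HilbertTensor H →L[ℂ] HilbertTensor H)) : Prop :=
  ∀ X : TraceClass H, swap H * Φ X * swap H = Φ X

/-- Consistency with classical broadcasting in the orthonormal basis `b`:
`(D ⊗ D) ∘ Φ ∘ D = B_cl` on trace class operators. -/
def IsClassicallyConsistent
    (Φ : TraceClass H →L[ℂ] (HilbertTensor H →L[ℂ] HilbertTensor H)) : Prop :=
  ∀ X : TraceClass H, tensorDiagonal b (Φ (X.diagonal b)) = classicalBroadcast b X

end Broadcast

end VirtualBroadcast

end

noncomputable section

namespace VirtualBroadcast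

open InnerProductSpace

/-! ### Trace norm approximation by matrix units -/

section Approximation

variable {H : Type*} [NormedAddCommGroup H] [InnerProductSpace ℂ H] [CompleteSpace H]
  {ι : Type*} (b : HilbertBasis ι ℂ H)

/-! The formula on the right defines a bounded map, `canonicalBroadcast`, and direct computation on
elementary tensors shows that it satisfies the three conditions. Uniqueness is linear: the
difference `Ψ` of two solutions is covariant and permutation invariant, and every image `Ψ(E_kk)` of
a diagonal matrix unit has zero diagonal in the product basis (`IsClassicallyConsistent.inner_eq`).
It remains to show `Ψ = 0`, and two families of unitaries suffice.

Coordinate phases force `Ψ(E_kk)` to connect `e_i ⊗ e_j` only with itself and with `e_j ⊗ e_i`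
(`IsUnitaryCovariant.entry_eq_zero`). With zero diagonal, one number `q k i j` is left for each
pair, the coefficient of the flip. Permutation invariance makes it symmetric in `i` and `j`.
Unitaries of the plane of `e_i, e_j` show that `q k i j = 0` for `k` outside the plane, that `q i i
j + q j i j = 0`, and, through the exchange of the two vectors, that `q i i j = q j i j`. Hence all
of them vanish (`IsUnitaryCovariant.apply_ketBra_self_eq_zero`).

Rotating `E_kk` in a plane produces off-diagonal units, so covariance carries the vanishing over to
these (`IsUnitaryCovariant.eq_zero`). In infinite dimension the last point is that matrix units span
a trace norm dense subspace (`TraceClass.hasSum_ketBra`, `eq_zero_of_ketBra`); continuity of `Ψ`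
finishes the proof. -/

lemma inner_basis [DecidableEq ι] (i j : ι) : ⟪b i, b j⟫_ℂ = if i = j then 1 else 0 :=
  orthonormal_iff_ite.mp b.orthonormal i j

lemma ext_basis {E : Type*} [NormedAddCommGroup E] [NormedSpace ℂ E] {A B : H →L[ℂ] E}
    (h : ∀ i, A (b i) = B (b i)) : A = B := by
  refine ContinuousLinearMap.ext_on (s := Set.range b) ?_ ?_
  · rw [Submodule.dense_iff_topologicalClosure_eq_top]
    exact b.dense_span
  · rintro _ ⟨i, rfl⟩
    exact h i

lemma enorm_inner_le (x y : H) : ‖⟪x, y⟫_ℂ‖ₑ ≤ ‖x‖ₑ * ‖y‖ₑ := by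
  simpa only [ofReal_norm, ENNReal.ofReal_mul (norm_nonneg x)] using
    ENNReal.ofReal_le_ofReal (norm_inner_le_norm (𝕜 := ℂ) x y)

/-- Tested in the basis `b` itself, the sum has a single nonzero term. The bound makes `x ↦ x e_i*`
continuous into the trace norm. -/
lemma traceENorm_rankOne_le (x : H) (i : ι) : traceENorm (rankOne ℂ x (b i)) ≤ ‖x‖ₑ := by
  classical
  refine traceENorm_le_of b _ fun W hW => ?_
  rw [tsum_eq_single i]
  · have h := enorm_inner_le (W (b i)) x
    have h1 : ‖W (b i)‖ₑ ≤ 1 := by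
      have h2 := enorm_apply_le hW (b i)
      rwa [← ofReal_norm (b i), b.orthonormal.1 i, ENNReal.ofReal_one] at h2
    rw [rankOne_apply, inner_basis, if_pos rfl, one_smul]
    exact h.trans (mul_le_of_le_one_left' h1)
  · intro j hj
    rw [rankOne_apply, inner_basis, if_neg hj.symm]
    simp

/-- The map `x ↦ x e_i*` from `H` to the trace class operators. -/
def TraceClass.ketBra (i : ι) : H →L[ℂ] TraceClass H :=
  LinearMap.mkContinuous
    { toFun := fun x => TraceClass.mk (rankOne ℂ x (b i))
        ((traceENorm_rankOne_le b x i).trans_lt enorm_lt_top)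
      map_add' := fun x y => TraceClass.toOp_injective (by simp)
      map_smul' := fun c x => TraceClass.toOp_injective (by simp) }
    1 fun x => by
      rw [one_mul, TraceClass.norm_def, ← toReal_enorm]
      exact ENNReal.toReal_mono enorm_ne_top (traceENorm_rankOne_le b x i)

@[simp] lemma TraceClass.toOp_ketBra (i : ι) (x : H) :
    (TraceClass.ketBra b i x).toOp = rankOne ℂ x (b i) := rfl

/-- The Hölder inequality `‖V* A* B‖₁ ≤ ‖A‖₂ ‖B‖₂` for a contraction `V`, with the factorization of
`Z` replaced by the weak estimate that it implies. -/
lemma traceENorm_le_hsSq {Z A B V : H →L[ℂ] H} (hV : ‖V‖ ≤ 1)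
    (hZ : ∀ i, ∀ x, ‖⟪x, Z (b i)⟫_ℂ‖ₑ ≤ ‖A (V x)‖ₑ * ‖B (b i)‖ₑ) :
    traceENorm Z ≤ hsSq b A ^ (1 / 2 : ℝ) * hsSq b B ^ (1 / 2 : ℝ) := by
  refine traceENorm_le_of b _ fun W hW => ?_
  have hVW : ‖V * W‖ ≤ 1 :=
    (norm_mul_le _ _).trans (mul_le_one₀ hV (norm_nonneg _) hW)
  refine (ENNReal.tsum_le_tsum fun i => hZ i (W (b i))).trans ?_
  -- Cauchy–Schwarz is applied to finite partial sums, with a bound independent of the finite set.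
  rw [ENNReal.tsum_eq_iSup_sum]
  refine iSup_le fun s => ?_
  have h := ENNReal.inner_le_Lp_mul_Lq s (fun i => ‖A (V (W (b i)))‖ₑ) (fun i => ‖B (b i)‖ₑ)
    (p := 2) (q := 2) Real.HolderConjugate.two_two
  simp only [ENNReal.rpow_ofNat] at h
  have hA : ∑ i ∈ s, ‖A (V (W (b i)))‖ₑ ^ 2 ≤ hsSq b A := by
    have h1 := hsSq_mul_le b A hVW
    simp only [hsSq, mul_apply_eq_comp] at h1
    exact (ENNReal.sum_le_tsum s).trans h1
  have hB : ∑ i ∈ s, ‖B (b i)‖ₑ ^ 2 ≤ hsSq b B := ENNReal.sum_le_tsum s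
  have hhalf : (0 : ℝ) ≤ 1 / 2 := by norm_num
  exact h.trans (mul_le_mul' (ENNReal.rpow_le_rpow hA hhalf) (ENNReal.rpow_le_rpow hB hhalf))

/-- Write `X = V R R` with `R = |X|^{1/2}` Hilbert-Schmidt, and let `P_s` project onto the span of
the `e_j` with `j ∈ s`. The remainder of the partial sum over `s` is `X(1 - P_s) = V R · R(1 -
P_s)`, so its trace norm is at most `‖R‖₂ ‖R(1 - P_s)‖₂`. The second factor is the square root of a
tail of the convergent series `∑ ‖R e_i‖²`. -/
lemma TraceClass.hasSum_ketBra (X : TraceClass H) :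
    HasSum (fun i => TraceClass.ketBra b i (X.toOp (b i))) X := by
  classical
  obtain ⟨V, hV, hVX⟩ := exists_polar X.toOp
  set R := CFC.sqrt (CFC.abs X.toOp) with hR
  have hRR : R * R = CFC.abs X.toOp := CFC.sqrt_mul_sqrt_self _ (CFC.abs_nonneg _)
  have hRs : star R = R := (CFC.sqrt_nonneg _).isSelfAdjoint.star_eq
  have hRX : hsSq b R = traceENorm X.toOp := (traceENorm_eq_hsSq b _).symm
  have hfin : hsSq b R ≠ ∞ := hRX ▸ X.traceENorm_lt_top.ne
  have hinner : ∀ i x, ‖⟪x, X.toOp (b i)⟫_ℂ‖ₑ ≤ ‖R (star V x)‖ₑ * ‖R (b i)‖ₑ := by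
    intro i x
    have h3 : ⟪x, X.toOp (b i)⟫_ℂ = ⟪R (star V x), R (b i)⟫_ℂ := by
      conv_lhs => rw [← hVX, ← hRR]
      conv_rhs => rw [← hRs]
      simp only [mul_apply_eq_comp, ContinuousLinearMap.star_eq_adjoint,
        ContinuousLinearMap.adjoint_inner_left]
      rw [← ContinuousLinearMap.star_eq_adjoint, hRs]
    rw [h3]
    exact enorm_inner_le _ _
  have happ : ∀ (s : Finset ι) (i : ι),
      (X - ∑ j ∈ s, TraceClass.ketBra b j (X.toOp (b j))).toOp (b i) =
        if i ∈ s then 0 else X.toOp (b i) := by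
    intro s i
    simp only [map_sub, map_sum, TraceClass.toOp_ketBra, sub_apply, sum_apply,
      rankOne_apply, inner_basis, ite_smul, one_smul, zero_smul, Finset.sum_ite_eq']
    split_ifs <;> simp
  -- The operator on the left is `R(1 - P_s)`, which kills `e_j` for `j ∈ s` and agrees with `R` on
  -- the other basis vectors.
  have hproj : ∀ s : Finset ι,
      hsSq b (R - ∑ j ∈ s, rankOne ℂ (R (b j)) (b j)) =
        ∑' i : { i // i ∉ s }, ‖R (b i)‖ₑ ^ 2 := by
    intro s
    have h1 : ∑' i : { i // i ∉ s }, ‖R (b i)‖ₑ ^ 2 =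
        ∑' i, if i ∈ s then 0 else ‖R (b i)‖ₑ ^ 2 := by
      have h2 : Function.support (fun i => if i ∈ s then 0 else ‖R (b i)‖ₑ ^ 2) ⊆
          Set.range (Subtype.val : { i // i ∉ s } → ι) := by
        intro i hi
        by_contra h3
        simp only [Subtype.range_coe_subtype, Set.mem_ofPred_eq, not_not] at h3
        simp [h3] at hi
      rw [← Subtype.val_injective.tsum_eq h2]
      exact tsum_congr fun i => by simp [i.2]
    rw [h1, hsSq]
    refine tsum_congr fun i => ?_
    simp only [sub_apply, sum_apply, rankOne_apply, inner_basis, ite_smul,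
      one_smul, zero_smul, Finset.sum_ite_eq']
    by_cases h : i ∈ s <;> simp [h]
  have hbound : ∀ s : Finset ι,
      traceENorm (X - ∑ j ∈ s, TraceClass.ketBra b j (X.toOp (b j))).toOp ≤
        hsSq b R ^ (1 / 2 : ℝ) * (∑' i : { i // i ∉ s }, ‖R (b i)‖ₑ ^ 2) ^ (1 / 2 : ℝ) := by
    intro s
    rw [← hproj s]
    refine traceENorm_le_hsSq b (norm_star_le_one hV) fun i x => ?_
    rw [happ]
    simp only [sub_apply, sum_apply, rankOne_apply, inner_basis, ite_smul,
      one_smul, zero_smul, Finset.sum_ite_eq']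
    split_ifs
    · simp
    · simpa using hinner i x
  have htail : Filter.Tendsto (fun s : Finset ι => hsSq b R ^ (1 / 2 : ℝ) *
      (∑' i : { i // i ∉ s }, ‖R (b i)‖ₑ ^ 2) ^ (1 / 2 : ℝ)) Filter.atTop (nhds 0) := by
    have h1 := ENNReal.tendsto_tsum_compl_atTop_zero (f := fun i => ‖R (b i)‖ₑ ^ 2) hfin
    have h2 := (ENNReal.continuous_rpow_const (y := (1 / 2 : ℝ))).tendsto 0 |>.comp h1
    rw [ENNReal.zero_rpow_of_pos (by norm_num)] at h2
    have h3 := ENNReal.Tendsto.const_mul (a := hsSq b R ^ (1 / 2 : ℝ)) h2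
      (Or.inr (ENNReal.rpow_ne_top_of_nonneg (by norm_num) hfin))
    simpa using h3
  have h0 := tendsto_of_tendsto_of_tendsto_of_le_of_le tendsto_const_nhds htail
    (fun _ => zero_le) hbound
  rw [HasSum, SummationFilter.unconditional_filter, tendsto_iff_norm_sub_tendsto_zero]
  have h1 := (ENNReal.tendsto_toReal ENNReal.zero_ne_top).comp h0
  refine h1.congr fun s => ?_
  rw [norm_sub_rev]
  rfl

/-- Density is used twice: in `H` to pass from `e_k e_l*` to `x e_l*`, then in trace norm to pass to
an arbitrary `X`. -/
lemma eq_zero_of_ketBra {E : Type*} [NormedAddCommGroup E] [NormedSpace ℂ E]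
    {Ψ : TraceClass H →L[ℂ] E} (h : ∀ k l, Ψ (TraceClass.ketBra b l (b k)) = 0) : Ψ = 0 := by
  have h1 : ∀ l x, Ψ (TraceClass.ketBra b l x) = 0 := fun l x =>
    DFunLike.congr_fun (ext_basis b (A := Ψ ∘L TraceClass.ketBra b l) (B := 0)
      fun k => by simpa using h k l) x
  ext X
  have h2 := (TraceClass.hasSum_ketBra b X).mapL Ψ
  simp only [h1] at h2
  exact h2.unique hasSum_zero

/-- The operator norm of `R = |X|^{1/2}` is at most its Hilbert-Schmidt norm, by Parseval, and `|X|
= R²`. This makes `canonicalBroadcast` continuous for the trace norm. -/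
lemma norm_toOp_le (X : TraceClass H) : ‖X.toOp‖ ≤ ‖X‖ := by
  set R := CFC.sqrt (CFC.abs X.toOp) with hR
  have hRR : R * R = CFC.abs X.toOp := CFC.sqrt_mul_sqrt_self _ (CFC.abs_nonneg _)
  have hRs : star R = R := (CFC.sqrt_nonneg _).isSelfAdjoint.star_eq
  have hRX : hsSq (stdBasis H) R = traceENorm X.toOp := (traceENorm_eq_hsSq _ _).symm
  have h1 : ∀ x, ‖R x‖ₑ ^ 2 ≤ traceENorm X.toOp * ‖x‖ₑ ^ 2 := by
    intro x
    rw [parseval (stdBasis H), ← hRX, hsSq, ← ENNReal.tsum_mul_right]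
    refine ENNReal.tsum_le_tsum fun i => ?_
    rw [← mul_pow]
    gcongr
    conv_lhs => rw [← hRs]
    rw [ContinuousLinearMap.star_eq_adjoint, ContinuousLinearMap.adjoint_inner_right]
    exact enorm_inner_le _ _
  have h2 : ∀ x, ‖R x‖ ^ 2 ≤ ‖X‖ * ‖x‖ ^ 2 := by
    intro x
    have h3 := ENNReal.toReal_mono
      (ENNReal.mul_ne_top X.traceENorm_lt_top.ne (by finiteness)) (h1 x)
    simpa [TraceClass.norm_def] using h3
  have h3 : ‖R‖ ^ 2 ≤ ‖X‖ := by
    have h4 : ‖R‖ ≤ √‖X‖ := by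
      refine R.opNorm_le_bound (Real.sqrt_nonneg _) fun x => ?_
      refine abs_le_of_sq_le_sq' ?_ (by positivity) |>.2
      rw [mul_pow, Real.sq_sqrt (norm_nonneg _)]
      exact h2 x
    calc ‖R‖ ^ 2 ≤ √‖X‖ ^ 2 := by gcongr
      _ = ‖X‖ := Real.sq_sqrt (norm_nonneg _)
  have h4 : ‖CFC.abs X.toOp‖ ≤ ‖X‖ := by
    rw [← hRR]
    exact (norm_mul_le _ _).trans (by nlinarith)
  refine X.toOp.opNorm_le_bound (norm_nonneg _) fun x => ?_
  rw [← norm_abs_apply]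
  exact (CFC.abs X.toOp).le_of_opNorm_le h4 x

end Approximation

/-! ### The canonical map and its three properties -/

section Canonical

variable {H : Type*} [NormedAddCommGroup H] [InnerProductSpace ℂ H]

lemma tmul_add (x y z : H) : tmul x (y + z) = tmul x y + tmul x z := (tmulRight x).map_add y z

lemma add_tmul (x y z : H) : tmul (x + y) z = tmul x z + tmul y z := (tmulLeft z).map_add x y

lemma tmul_smul (c : ℂ) (x y : H) : tmul x (c • y) = c • tmul x y := (tmulRight x).map_smul c y

lemma smul_tmul (c : ℂ) (x y : H) : tmul (c • x) y = c • tmul x y := (tmulLeft y).map_smul c x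

lemma zero_tmul (y : H) : tmul 0 y = 0 := (tmulLeft y).map_zero

lemma ext_tmul {Y Z : HilbertTensor H →L[ℂ] HilbertTensor H}
    (h : ∀ x y, Y (tmul x y) = Z (tmul x y)) : Y = Z := by
  ext z
  induction z using HilbertTensor.denseRange_incl.induction_on with
  | hp => exact isClosed_eq (by fun_prop) (by fun_prop)
  | ih z =>
    induction z using TensorProduct.induction_on with
    | zero => simp
    | tmul x y => exact h x y
    | add x y hx hy => simp only [map_add, hx, hy]

variable [CompleteSpace H]

variable (H) in
/-- The canonical virtual broadcasting map `X ↦ (S (I ⊗ X) + S (X ⊗ I)) / 2`. -/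
def canonicalBroadcast : TraceClass H →L[ℂ] (HilbertTensor H →L[ℂ] HilbertTensor H) :=
  LinearMap.mkContinuous
    { toFun := fun X => (1 / 2 : ℂ) •
        (swap H * tensorOp 1 X.toOp + swap H * tensorOp X.toOp 1)
      map_add' := fun X Y => ext_tmul fun x y => by
        simp [tmul_add, add_tmul]
        module
      map_smul' := fun c X => ext_tmul fun x y => by
        simp [tmul_smul, smul_tmul]
        module }
    ‖swap H‖ fun X => by
      have h1 : ‖(1 : H →L[ℂ] H)‖ ≤ 1 := ContinuousLinearMap.norm_id_le
      have hX := norm_toOp_le X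
      have h2 : ‖swap H * tensorOp 1 X.toOp‖ ≤ ‖swap H‖ * ‖X‖ := by
        refine (norm_mul_le _ _).trans ?_
        gcongr
        refine (norm_tensorOp_le _ _).trans ?_
        nlinarith [norm_nonneg X.toOp]
      have h3 : ‖swap H * tensorOp X.toOp 1‖ ≤ ‖swap H‖ * ‖X‖ := by
        refine (norm_mul_le _ _).trans ?_
        gcongr
        refine (norm_tensorOp_le _ _).trans ?_
        nlinarith [norm_nonneg X.toOp]
      have h4 := norm_add_le (swap H * tensorOp 1 X.toOp) (swap H * tensorOp X.toOp 1)
      change ‖(1 / 2 : ℂ) • (swap H * tensorOp 1 X.toOp + swap H * tensorOp X.toOp 1)‖ ≤ _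
      rw [norm_smul]
      norm_num
      linarith

lemma canonicalBroadcast_apply (X : TraceClass H) :
    canonicalBroadcast H X = (1 / 2 : ℂ) •
      (swap H * tensorOp 1 X.toOp + swap H * tensorOp X.toOp 1) := rfl

lemma canonicalBroadcast_tmul (X : TraceClass H) (x y : H) :
    canonicalBroadcast H X (tmul x y) =
      (1 / 2 : ℂ) • (tmul (X.toOp y) x + tmul y (X.toOp x)) := by
  simp [canonicalBroadcast_apply]

lemma isUnitaryCovariant_canonicalBroadcast : IsUnitaryCovariant (canonicalBroadcast H) := by
  intro U X
  have hU : ∀ x, (U : H →L[ℂ] H) (star (U : H →L[ℂ] H) x) = x := fun x => by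
    rw [← mul_apply_eq_comp, Unitary.mul_star_self_of_mem U.2, one_apply_eq_self]
  refine ext_tmul fun x y => ?_
  simp [canonicalBroadcast_tmul, TraceClass.conj, hU]

lemma isPermutationInvariant_canonicalBroadcast :
    IsPermutationInvariant (canonicalBroadcast H) := by
  intro X
  refine ext_tmul fun x y => ?_
  simp [canonicalBroadcast_tmul, add_comm]

variable {ι : Type*} (b : HilbertBasis ι ℂ H)

/-- For diagonal `D(X)` with entries `d_i`, the map sends `e_i ⊗ e_j` to `(d_i + d_j)/2` times `e_j
⊗ e_i`. This is orthogonal to `e_i ⊗ e_j` unless `i = j`, when the entry is `d_i`. -/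
lemma isClassicallyConsistent_canonicalBroadcast :
    IsClassicallyConsistent b (canonicalBroadcast H) := by
  classical
  intro X
  refine ext_tensorBasis b fun i j => ?_
  have hl := diagonal_apply_basis (tensorBasis b) (canonicalBroadcast H (X.diagonal b)) (i, j)
  rw [tensorBasis_apply] at hl
  have hr := ((hasSum_classicalBroadcast b X).mapL
    (ContinuousLinearMap.apply ℂ (HilbertTensor H) (tmul (b i) (b j)))).tsum_eq
  rw [ContinuousLinearMap.apply_apply] at hr
  rw [tensorDiagonal, hl, ← hr, tsum_eq_single i]
  · simp only [canonicalBroadcast_tmul, TraceClass.diagonal, TraceClass.toOp_mk,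
      diagonal_apply_basis, smul_tmul, tmul_smul, inner_smul_right, inner_add_right, inner_tmul,
      inner_basis, ContinuousLinearMap.apply_apply, smul_apply, tensorOp_tmul, rankOne_apply]
    by_cases h : i = j
    · subst h
      simp
      module
    · simp [h, Ne.symm h]
  · intro k hk
    simp [inner_basis, hk, zero_tmul]

end Canonical

open ComplexConjugate

/-! ### Phase unitaries and the matrix entries of a covariant map -/

section Uniqueness

variable {H : Type*} [NormedAddCommGroup H] [InnerProductSpace ℂ H] [CompleteSpace H]

/-- The unitary `1 + (c - 1) P` for a projection `P` and a scalar `c` of modulus one. -/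
def phaseUnitary {P : H →L[ℂ] H} (hP : IsStarProjection P) {c : ℂ} (hc : conj c * c = 1) :
    unitary (H →L[ℂ] H) :=
  ⟨1 + (c - 1) • P, by
    have h1 : P * P = P := hP.isIdempotentElem
    have h2 : star P = P := hP.isSelfAdjoint
    -- The left side is the coefficient of `P` in `(1 + (conj c - 1) P)(1 + (c - 1) P)`.
    have h3 : (conj c - 1) * (c - 1) + (c - 1) + (conj c - 1) = 0 := by linear_combination hc
    have h4 : ∀ a d : ℂ, a * d + d + a = 0 → (1 + a • P) * (1 + d • P) = 1 := by
      intro a d h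
      have h5 : (1 + a • P) * (1 + d • P) = 1 + (a * d + d + a) • P := by
        simp only [mul_add, add_mul, one_mul, mul_one, smul_mul_smul_comm, h1]
        module
      rw [h5, h, zero_smul, add_zero]
    have h6 : star (1 + (c - 1) • P) = 1 + (conj c - 1) • P := by
      simp [h2]
    rw [Unitary.mem_iff, h6]
    exact ⟨h4 _ _ h3, h4 _ _ (by linear_combination h3)⟩⟩

lemma phaseUnitary_apply {P : H →L[ℂ] H} (hP : IsStarProjection P) {c : ℂ}
    (hc : conj c * c = 1) (x : H) :
    (phaseUnitary hP hc : H →L[ℂ] H) x = x + (c - 1) • P x := rfl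

lemma conj_I_mul_I : conj Complex.I * Complex.I = 1 := by simp

lemma unitary_star_apply (U : unitary (H →L[ℂ] H)) (x : H) :
    star (U : H →L[ℂ] H) ((U : H →L[ℂ] H) x) = x := by
  rw [← mul_apply_eq_comp, Unitary.star_mul_self_of_mem U.2, one_apply_eq_self]

/-- A weak form of `(A ⊗ B)* = A* ⊗ B*`, extended by density to all vectors `v`. -/
lemma inner_tmul_tensorOp (A B : H →L[ℂ] H) (x y : H) (v : HilbertTensor H) :
    ⟪tmul x y, tensorOp A B v⟫_ℂ = ⟪tmul (star A x) (star B y), v⟫_ℂ := by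
  induction v using HilbertTensor.denseRange_incl.induction_on with
  | hp => exact isClosed_eq (by fun_prop) (by fun_prop)
  | ih z =>
    induction z using TensorProduct.induction_on with
    | zero => simp
    | tmul z w =>
      change ⟪tmul x y, tensorOp A B (tmul z w)⟫_ℂ = ⟪_, tmul z w⟫_ℂ
      simp only [tensorOp_tmul, inner_tmul, ContinuousLinearMap.star_eq_adjoint,
        ContinuousLinearMap.adjoint_inner_left]
    | add x y hx hy => simp only [map_add, inner_add_right, hx, hy]

variable {Ψ : TraceClass H →L[ℂ] (HilbertTensor H →L[ℂ] HilbertTensor H)}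

/-- Covariance as invariance of matrix entries: every later relation comes from a choice of `U` and
four basis vectors. -/
lemma IsUnitaryCovariant.inner_conj (hΨ : IsUnitaryCovariant Ψ) (U : unitary (H →L[ℂ] H))
    (X : TraceClass H) (x y z w : H) :
    ⟪tmul ((U : H →L[ℂ] H) x) ((U : H →L[ℂ] H) y),
      Ψ (X.conj U) (tmul ((U : H →L[ℂ] H) z) ((U : H →L[ℂ] H) w))⟫_ℂ =
      ⟪tmul x y, Ψ X (tmul z w)⟫_ℂ := by
  rw [hΨ U X]
  simp only [mul_apply_eq_comp, tensorOp_tmul, unitary_star_apply, inner_tmul_tensorOp]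

lemma TraceClass.toOp_conj_apply (U : unitary (H →L[ℂ] H)) (X : TraceClass H) (x : H) :
    (X.conj U).toOp x = (U : H →L[ℂ] H) (X.toOp (star (U : H →L[ℂ] H) x)) := rfl

variable {ι : Type*} (b : HilbertBasis ι ℂ H)

lemma TraceClass.toOp_conj_ketBra (U : unitary (H →L[ℂ] H)) (l : ι) (x : H) :
    ((TraceClass.ketBra b l x).conj U).toOp =
      rankOne ℂ ((U : H →L[ℂ] H) x) ((U : H →L[ℂ] H) (b l)) := by
  ext z
  rw [TraceClass.toOp_conj_apply]
  simp only [TraceClass.toOp_ketBra, rankOne_apply, map_smul, ContinuousLinearMap.star_eq_adjoint,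
    ContinuousLinearMap.adjoint_inner_right]

lemma TraceClass.conj_add (U : unitary (H →L[ℂ] H)) (X Y : TraceClass H) :
    (X + Y).conj U = X.conj U + Y.conj U :=
  TraceClass.toOp_injective <| by
    ext x
    simp [TraceClass.toOp_conj_apply]

lemma TraceClass.conj_ketBra_of_eigenvector {U : unitary (H →L[ℂ] H)} {k l : ι} {c d : ℂ}
    (hk : (U : H →L[ℂ] H) (b k) = c • b k) (hl : (U : H →L[ℂ] H) (b l) = d • b l) :
    (TraceClass.ketBra b l (b k)).conj U = (conj d * c) • TraceClass.ketBra b l (b k) :=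
  TraceClass.toOp_injective <| by
    rw [TraceClass.toOp_conj_ketBra, hk, hl]
    simp [smul_smul, mul_comm]

lemma TraceClass.diagonal_ketBra (k : ι) :
    (TraceClass.ketBra b k (b k)).diagonal b = TraceClass.ketBra b k (b k) := by
  classical
  refine TraceClass.toOp_injective (ext_basis b fun i => ?_)
  rw [TraceClass.diagonal, TraceClass.toOp_mk, diagonal_apply_basis]
  by_cases h : k = i
  · subst h
    simp only [TraceClass.toOp_ketBra, rankOne_apply, inner_basis, if_true, one_smul]
  · simp [inner_basis, h]

lemma isStarProjection_rankOne_basis (i : ι) : IsStarProjection (rankOne ℂ (b i) (b i)) :=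
  isStarProjection_rankOne_self (b.orthonormal.1 i)

/-- The unitary that multiplies `e_i` by `I` and fixes the other basis vectors. -/
def coordPhase (i : ι) : unitary (H →L[ℂ] H) :=
  phaseUnitary (isStarProjection_rankOne_basis b i) conj_I_mul_I

lemma coordPhase_apply [DecidableEq ι] (i j : ι) :
    (coordPhase b i : H →L[ℂ] H) (b j) = (if i = j then Complex.I else 1) • b j := by
  rw [coordPhase, phaseUnitary_apply, rankOne_apply, inner_basis]
  split_ifs with h
  · subst h; module
  · simp

lemma isStarProjection_plane {i j : ι} (hij : i ≠ j) :
    IsStarProjection ((1 / 2 : ℂ) • rankOne ℂ (b i + b j) (b i + b j)) := by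
  classical
  constructor
  · ext z
    simp only [mul_apply_eq_comp, smul_apply, rankOne_apply, inner_smul_right, inner_add_right,
      inner_add_left, inner_basis, hij, hij.symm, if_true, if_false]
    module
  · rw [isSelfAdjoint_iff, star_smul, ContinuousLinearMap.star_eq_adjoint, adjoint_rankOne]
    norm_num

/-- The unitary with eigenvalue `c` on `e_i + e_j` and `1` on its orthogonal complement. -/
def planePhase {i j : ι} (hij : i ≠ j) {c : ℂ} (hc : conj c * c = 1) : unitary (H →L[ℂ] H) :=
  phaseUnitary (isStarProjection_plane b hij) hc

section PlanePhase

variable {i j : ι} (hij : i ≠ j) {c : ℂ} (hc : conj c * c = 1)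

lemma planePhase_left :
    (planePhase b hij hc : H →L[ℂ] H) (b i) = ((c + 1) / 2) • b i + ((c - 1) / 2) • b j := by
  classical
  rw [planePhase, phaseUnitary_apply]
  simp only [smul_apply, rankOne_apply, inner_add_left, inner_basis, hij.symm, if_true, if_false]
  module

lemma planePhase_right :
    (planePhase b hij hc : H →L[ℂ] H) (b j) = ((c - 1) / 2) • b i + ((c + 1) / 2) • b j := by
  classical
  rw [planePhase, phaseUnitary_apply]
  simp only [smul_apply, rankOne_apply, inner_add_left, inner_basis, hij, if_true, if_false]
  module

lemma planePhase_of_ne {k : ι} (hi : i ≠ k) (hj : j ≠ k) :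
    (planePhase b hij hc : H →L[ℂ] H) (b k) = b k := by
  classical
  rw [planePhase, phaseUnitary_apply]
  simp [inner_basis, hi, hj]

end PlanePhase

/-- The sum is the projection onto the plane of `e_i, e_j`, which the unitary maps onto itself. -/
lemma conj_planePhase_add {i j : ι} (hij : i ≠ j) {c : ℂ} (hc : conj c * c = 1) :
    (TraceClass.ketBra b i (b i) + TraceClass.ketBra b j (b j)).conj (planePhase b hij hc) =
      TraceClass.ketBra b i (b i) + TraceClass.ketBra b j (b j) :=
  TraceClass.toOp_injective <| by
    ext z
    rw [TraceClass.conj_add, map_add, map_add, TraceClass.toOp_conj_ketBra,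
      TraceClass.toOp_conj_ketBra, planePhase_left, planePhase_right]
    simp only [add_apply, rankOne_apply, inner_smul_left, map_div₀, _root_.map_add,
      map_sub, map_one, map_ofNat, TraceClass.toOp_ketBra]
    match_scalars
    · linear_combination ((⟪b i, z⟫_ℂ + ⟪b j, z⟫_ℂ) / 2) * hc
    · linear_combination ((⟪b i, z⟫_ℂ + ⟪b j, z⟫_ℂ) / 2) * hc

/-- For `c = -1` the unitary exchanges `e_i` and `e_j` up to the sign `-1`, which cancels in the
conjugation. -/
lemma conj_planePhase_neg_one {i j : ι} (hij : i ≠ j) (hc : conj (-1 : ℂ) * (-1) = 1) :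
    (TraceClass.ketBra b i (b i)).conj (planePhase b hij hc) = TraceClass.ketBra b j (b j) :=
  TraceClass.toOp_injective <| by
    rw [TraceClass.toOp_conj_ketBra, planePhase_left]
    norm_num

/-- Only the matrix entries between `e_i ⊗ e_j` and `e_i ⊗ e_j` or `e_j ⊗ e_i` of the image of a
diagonal matrix unit under a covariant map are nonzero. -/
lemma IsUnitaryCovariant.entry_eq_zero (hΨ : IsUnitaryCovariant Ψ) (k : ι) {m n i j : ι}
    (h1 : ¬(m = i ∧ n = j)) (h2 : ¬(m = j ∧ n = i)) :
    ⟪tmul (b m) (b n), Ψ (TraceClass.ketBra b k (b k)) (tmul (b i) (b j))⟫_ℂ = 0 := by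
  classical
  by_contra h0
  -- The phase is `I` to the power (occurrences of `p` in `i, j`) minus (occurrences in `m, n`). The
  -- exponent lies between `-2` and `2`, so a phase of order four detects every mismatch; the phase
  -- `-1` would miss `±2`.
  have key : ∀ p : ι,
      conj (if p = m then Complex.I else 1) * conj (if p = n then Complex.I else 1) *
        ((if p = i then Complex.I else 1) * (if p = j then Complex.I else 1)) = 1 := by
    intro p
    have h := hΨ.inner_conj (coordPhase b p) (TraceClass.ketBra b k (b k)) (b m) (b n) (b i) (b j)
    rw [TraceClass.conj_ketBra_of_eigenvector b (coordPhase_apply b p k)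
      (coordPhase_apply b p k)] at h
    have h3 : conj (if p = k then Complex.I else 1) * (if p = k then Complex.I else 1) = 1 := by
      split_ifs <;> simp
    rw [h3, one_smul] at h
    simp only [coordPhase_apply, smul_tmul_smul, map_smul, inner_smul_left, inner_smul_right,
      map_mul] at h
    exact mul_right_cancel₀ h0 (by linear_combination h)
  -- Equal numbers of occurrences of `m` and of `n` already force the pairs to agree up to order.
  have hm := key m
  have hn := key n
  clear key h0
  by_cases a1 : m = i <;> by_cases a2 : m = j <;> by_cases a3 : n = i <;> by_cases a4 : n = j <;>
    by_cases a5 : m = n <;> by_cases a6 : i = j <;> simp_all [Complex.ext_iff] <;>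
    norm_num at *

end Uniqueness

/-! ### Vanishing of the difference of two solutions -/

section Vanishing

variable {H : Type*} [NormedAddCommGroup H] [InnerProductSpace ℂ H] [CompleteSpace H]
  {Ψ : TraceClass H →L[ℂ] (HilbertTensor H →L[ℂ] HilbertTensor H)}
  {ι : Type*} (b : HilbertBasis ι ℂ H)

lemma ext_inner_tmul {v w : HilbertTensor H}
    (h : ∀ m n, ⟪tmul (b m) (b n), v⟫_ℂ = ⟪tmul (b m) (b n), w⟫_ℂ) : v = w := by
  refine (tensorBasis b).repr.injective (lp.ext (funext fun p => ?_))
  rw [(tensorBasis b).repr_apply_apply, (tensorBasis b).repr_apply_apply]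
  obtain ⟨m, n⟩ := p
  simpa only [tensorBasis_apply] using h m n

/-- The expectation, in the product vector `u ⊗ u` with `u = ((I + 1) e_i + (I - 1) e_j) / 2`, of
an operator that acts on the span of `e_i ⊗ e_i`, `e_i ⊗ e_j`, `e_j ⊗ e_i`, `e_j ⊗ e_j` as `q`
times the swap of `e_i ⊗ e_j` and `e_j ⊗ e_i`. -/
lemma inner_planePhase {C : HilbertTensor H →L[ℂ] HilbertTensor H} {i j : ι} (hij : i ≠ j) {q : ℂ}
    (hii : C (tmul (b i) (b i)) = 0) (hjj : C (tmul (b j) (b j)) = 0)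
    (hij' : C (tmul (b i) (b j)) = q • tmul (b j) (b i))
    (hji : C (tmul (b j) (b i)) = q • tmul (b i) (b j)) :
    ⟪tmul ((planePhase b hij conj_I_mul_I : H →L[ℂ] H) (b i))
        ((planePhase b hij conj_I_mul_I : H →L[ℂ] H) (b i)),
      C (tmul ((planePhase b hij conj_I_mul_I : H →L[ℂ] H) (b i))
        ((planePhase b hij conj_I_mul_I : H →L[ℂ] H) (b i)))⟫_ℂ = q / 2 := by
  classical
  rw [planePhase_left]
  simp only [tmul_add, add_tmul, tmul_smul, smul_tmul, map_add, map_smul, hii, hjj, hij', hji,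
    inner_add_left, inner_add_right, inner_smul_left, inner_smul_right, inner_tmul, inner_basis,
    hij, hij.symm, if_true, if_false, smul_zero, inner_zero_right]
  simp only [map_div₀, map_add, map_sub, map_one, map_ofNat, Complex.conj_I]
  ring_nf
  simp only [Complex.I_sq, Complex.I_pow_four]
  ring

lemma IsUnitaryCovariant.apply_tmul_self (hcov : IsUnitaryCovariant Ψ)
    (hdiag : ∀ k i j, ⟪tmul (b i) (b j),
      Ψ (TraceClass.ketBra b k (b k)) (tmul (b i) (b j))⟫_ℂ = 0)
    (k i : ι) : Ψ (TraceClass.ketBra b k (b k)) (tmul (b i) (b i)) = 0 := by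
  refine ext_inner_tmul b fun m n => ?_
  rw [inner_zero_right]
  by_cases h : m = i ∧ n = i
  · rw [h.1, h.2, hdiag]
  · exact hcov.entry_eq_zero b k h h

lemma IsUnitaryCovariant.apply_tmul_of_ne (hcov : IsUnitaryCovariant Ψ)
    (hdiag : ∀ k i j, ⟪tmul (b i) (b j),
      Ψ (TraceClass.ketBra b k (b k)) (tmul (b i) (b j))⟫_ℂ = 0)
    (k : ι) {i j : ι} (hij : i ≠ j) :
    Ψ (TraceClass.ketBra b k (b k)) (tmul (b i) (b j)) =
      ⟪tmul (b j) (b i), Ψ (TraceClass.ketBra b k (b k)) (tmul (b i) (b j))⟫_ℂ •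
        tmul (b j) (b i) := by
  classical
  refine ext_inner_tmul b fun m n => ?_
  rw [inner_smul_right, inner_tmul, inner_basis, inner_basis]
  by_cases h : m = i ∧ n = j
  · rw [h.1, h.2, hdiag]
    simp [hij]
  · by_cases h' : m = j ∧ n = i
    · simp [h'.1, h'.2]
    · rw [hcov.entry_eq_zero b k h h']
      by_cases hm : m = j
      · have hn : n ≠ i := fun hn => h' ⟨hm, hn⟩
        simp [hn]
      · simp [hm]

lemma IsPermutationInvariant.apply_tmul (hperm : IsPermutationInvariant Ψ) (X : TraceClass H)
    (x y : H) :
    Ψ X (tmul y x) = swap H (Ψ X (tmul x y)) := by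
  conv_lhs => rw [← hperm X]
  simp [mul_apply_eq_comp]

/-- What remains of `Ψ(E_kk)` is the flip coefficient `q k i j` on each pair. Its expectation in `u
⊗ u`, with `u` the rotated `e_i`, is half that coefficient, while its expectation in `e_i ⊗ e_i` is
zero. Any operator fixed by the rotation therefore gives a linear relation among the coefficients.
-/
lemma IsUnitaryCovariant.apply_ketBra_self_eq_zero (hcov : IsUnitaryCovariant Ψ)
    (hperm : IsPermutationInvariant Ψ)
    (hdiag : ∀ k i j, ⟪tmul (b i) (b j),
      Ψ (TraceClass.ketBra b k (b k)) (tmul (b i) (b j))⟫_ℂ = 0)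
    (k : ι) : Ψ (TraceClass.ketBra b k (b k)) = 0 := by
  classical
  set q : ι → ι → ι → ℂ := fun k i j =>
    ⟪tmul (b j) (b i), Ψ (TraceClass.ketBra b k (b k)) (tmul (b i) (b j))⟫_ℂ with hq
  have hself := hcov.apply_tmul_self b hdiag
  have hne : ∀ k {i j}, i ≠ j → Ψ (TraceClass.ketBra b k (b k)) (tmul (b i) (b j)) =
      q k i j • tmul (b j) (b i) := fun k _ _ hij => hcov.apply_tmul_of_ne b hdiag k hij
  have hne' : ∀ k {i j}, i ≠ j → Ψ (TraceClass.ketBra b k (b k)) (tmul (b j) (b i)) =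
      q k i j • tmul (b i) (b j) := fun k i j hij => by
    rw [hperm.apply_tmul, hne k hij, map_smul, swap_tmul]
  have hsymm : ∀ k {i j}, i ≠ j → q k j i = q k i j := fun k i j hij => by
    change ⟪_, _⟫_ℂ = _
    rw [hne' k hij, inner_smul_right, inner_tmul]
    simp only [inner_basis, if_true, mul_one]
  -- For `k` outside the plane, the rotation fixes `e_k` and hence `E_kk`.
  have hout : ∀ k {i j}, i ≠ j → i ≠ k → j ≠ k → q k i j = 0 := fun k i j hij hik hjk => by
    have h1 := hcov.inner_conj (planePhase b hij conj_I_mul_I) (TraceClass.ketBra b k (b k))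
      (b i) (b i) (b i) (b i)
    have hk : (planePhase b hij conj_I_mul_I : H →L[ℂ] H) (b k) = (1 : ℂ) • b k := by
      rw [planePhase_of_ne b hij _ hik hjk, one_smul]
    rw [TraceClass.conj_ketBra_of_eigenvector b hk hk, map_one, one_mul, one_smul,
      inner_planePhase b hij (hself k i) (hself k j) (hne k hij) (hne' k hij), hself,
      inner_zero_right] at h1
    simpa using h1
  -- Inside the plane only `E_ii + E_jj` is fixed by the rotation, so just the sum of the two
  -- coefficients is controlled.
  have hadd : ∀ {i j}, i ≠ j → q i i j + q j i j = 0 := fun {i j} hij => by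
    have h1 := hcov.inner_conj (planePhase b hij conj_I_mul_I)
      (TraceClass.ketBra b i (b i) + TraceClass.ketBra b j (b j)) (b i) (b i) (b i) (b i)
    rw [conj_planePhase_add, inner_planePhase b hij (q := q i i j + q j i j)
      (by simp [hself]) (by simp [hself]) (by simp [hne _ hij, add_smul])
      (by simp [hne' _ hij, add_smul])] at h1
    simpa [hself] using h1
  -- The exchange of `e_i` and `e_j` gives `q i i j = q j j i`. The symmetry `hsymm`, which rests on
  -- permutation invariance, turns this into a second relation independent of `hadd`.
  have heq : ∀ {i j}, i ≠ j → q i i j = q j i j := fun {i j} hij => by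
    have hc : conj (-1 : ℂ) * (-1) = 1 := by simp
    have h1 := hcov.inner_conj (planePhase b hij hc) (TraceClass.ketBra b i (b i))
      (b j) (b i) (b i) (b j)
    rw [conj_planePhase_neg_one, planePhase_left, planePhase_right] at h1
    norm_num [← neg_smul, smul_tmul, tmul_smul] at h1
    rw [← hsymm j hij]
    exact h1.symm
  have hzero : ∀ k {i j}, i ≠ j → q k i j = 0 := fun k i j hij => by
    by_cases hik : i = k
    · subst hik
      have h1 := hadd hij
      rw [← heq hij] at h1
      simpa using h1
    · by_cases hjk : j = k
      · subst hjk
        have h1 := hadd hij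
        rw [heq hij] at h1
        simpa using h1
      · exact hout k hij hik hjk
  refine ext_tensorBasis b fun i j => ?_
  rw [zero_apply]
  by_cases hij : i = j
  · subst hij
    exact hself k i
  · rw [hne k hij, hzero k hij, zero_smul]

/-- A covariant map that vanishes on the diagonal matrix units vanishes. -/
lemma IsUnitaryCovariant.eq_zero (hcov : IsUnitaryCovariant Ψ)
    (hdiag : ∀ k, Ψ (TraceClass.ketBra b k (b k)) = 0) : Ψ = 0 := by
  classical
  refine eq_zero_of_ketBra b fun k l => ?_
  by_cases hkl : k = l
  · subst hkl
    exact hdiag k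
  -- `E_kk` and its rotated copy both have image zero, and the rotated copy contains the difference
  -- of the two off-diagonal units with coefficient `I / 2`.
  have h1 : Ψ (TraceClass.ketBra b k (b l)) = Ψ (TraceClass.ketBra b l (b k)) := by
    have h2 := hcov (planePhase b hkl conj_I_mul_I) (TraceClass.ketBra b k (b k))
    have h3 : (TraceClass.ketBra b k (b k)).conj (planePhase b hkl conj_I_mul_I) =
        (1 / 2 : ℂ) • (TraceClass.ketBra b k (b k) + TraceClass.ketBra b l (b l) +
          Complex.I • (TraceClass.ketBra b k (b l) - TraceClass.ketBra b l (b k))) := by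
      refine TraceClass.toOp_injective ?_
      rw [TraceClass.toOp_conj_ketBra, planePhase_left]
      simp only [map_add, map_sub, map_smul, map_smulₛₗ, TraceClass.toOp_ketBra, add_apply,
        smul_apply, map_div₀, map_one, map_ofNat, Complex.conj_I]
      match_scalars <;> ring_nf <;> simp only [Complex.I_sq] <;> ring
    rw [h3, hdiag] at h2
    simp only [map_smul, map_add, map_sub, hdiag, mul_zero, zero_mul, zero_add] at h2
    simpa [sub_eq_zero] using h2
  -- The phase at `k` multiplies the two off-diagonal units by `-I` and `I`. Their images coincide
  -- by `h1`, so the common image equals its own negative.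
  have h4 : ∀ m n : ι, (TraceClass.ketBra b m (b n)).conj (coordPhase b k) =
      (conj (if k = m then Complex.I else 1) * (if k = n then Complex.I else 1)) •
        TraceClass.ketBra b m (b n) := fun m n =>
    TraceClass.conj_ketBra_of_eigenvector b (coordPhase_apply b k n) (coordPhase_apply b k m)
  have h5 := hcov (coordPhase b k) (TraceClass.ketBra b k (b l))
  have h6 := hcov (coordPhase b k) (TraceClass.ketBra b l (b k))
  rw [h1, ← h6, h4, h4, map_smul, map_smul, h1] at h5
  have h7 : (2 * Complex.I) • Ψ (TraceClass.ketBra b l (b k)) = 0 := by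
    simp only [if_true, if_neg hkl, Complex.conj_I, map_one, mul_one, one_mul] at h5
    rw [two_mul, add_smul]
    nth_rewrite 1 [← h5]
    rw [← add_smul, neg_add_cancel, zero_smul]
  simpa using h7

/-- `E_kk` is fixed by `D`, and `D ⊗ D` keeps exactly the diagonal entries in the product basis, so
consistency prescribes these entries of the image. -/
lemma IsClassicallyConsistent.inner_eq {Φ₁ Φ₂ : TraceClass H →L[ℂ]
    (HilbertTensor H →L[ℂ] HilbertTensor H)} (h₁ : IsClassicallyConsistent b Φ₁)
    (h₂ : IsClassicallyConsistent b Φ₂) (k i j : ι) :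
    ⟪tmul (b i) (b j), Φ₁ (TraceClass.ketBra b k (b k)) (tmul (b i) (b j))⟫_ℂ =
      ⟪tmul (b i) (b j), Φ₂ (TraceClass.ketBra b k (b k)) (tmul (b i) (b j))⟫_ℂ := by
  have h := (h₁ (TraceClass.ketBra b k (b k))).trans (h₂ (TraceClass.ketBra b k (b k))).symm
  rw [TraceClass.diagonal_ketBra] at h
  have h1 := DFunLike.congr_fun h (tensorBasis b (i, j))
  rw [tensorDiagonal, tensorDiagonal, diagonal_apply_basis, diagonal_apply_basis,
    tensorBasis_apply] at h1
  have h2 := congrArg (fun v => ⟪tmul (b i) (b j), v⟫_ℂ) h1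
  classical
  simpa only [inner_smul_right, inner_tmul, inner_basis, if_true, mul_one] using h2

lemma IsUnitaryCovariant.sub {Φ₁ Φ₂ : TraceClass H →L[ℂ]
    (HilbertTensor H →L[ℂ] HilbertTensor H)} (h₁ : IsUnitaryCovariant Φ₁)
    (h₂ : IsUnitaryCovariant Φ₂) : IsUnitaryCovariant (Φ₁ - Φ₂) := fun U X => by
  rw [sub_apply, sub_apply, h₁, h₂, mul_sub, sub_mul]

lemma IsPermutationInvariant.sub {Φ₁ Φ₂ : TraceClass H →L[ℂ]
    (HilbertTensor H →L[ℂ] HilbertTensor H)} (h₁ : IsPermutationInvariant Φ₁)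
    (h₂ : IsPermutationInvariant Φ₂) : IsPermutationInvariant (Φ₁ - Φ₂) := fun X => by
  rw [sub_apply, mul_sub, sub_mul, h₁, h₂]

/-- The canonical map is the only covariant, permutation invariant and classically consistent
one. -/
lemma eq_canonicalBroadcast {Φ : TraceClass H →L[ℂ] (HilbertTensor H →L[ℂ] HilbertTensor H)}
    (hcov : IsUnitaryCovariant Φ) (hperm : IsPermutationInvariant Φ)
    (hcons : IsClassicallyConsistent b Φ) : Φ = canonicalBroadcast H := by
  have hc := hcov.sub isUnitaryCovariant_canonicalBroadcast
  refine sub_eq_zero.mp (hc.eq_zero b fun k => hc.apply_ketBra_self_eq_zero b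
    (hperm.sub isPermutationInvariant_canonicalBroadcast) (fun k i j => ?_) k)
  rw [sub_apply, sub_apply, inner_sub_right, sub_eq_zero]
  exact hcons.inner_eq b (isClassicallyConsistent_canonicalBroadcast b) k i j

end Vanishing

end VirtualBroadcast

end

theorem corollary7 {H : Type*} [NormedAddCommGroup H] [InnerProductSpace ℂ H] [CompleteSpace H]
    [TopologicalSpace.SeparableSpace H] (hdim : 2 ≤ Module.rank ℂ H)
    {ι : Type*} (e : HilbertBasis ι ℂ H)
    (Φ : VirtualBroadcast.TraceClass H →L[ℂ]
      (VirtualBroadcast.HilbertTensor H →L[ℂ] VirtualBroadcast.HilbertTensor H)) :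
    (VirtualBroadcast.IsUnitaryCovariant Φ ∧ VirtualBroadcast.IsPermutationInvariant Φ ∧
        VirtualBroadcast.IsClassicallyConsistent e Φ) ↔
      ∀ X : VirtualBroadcast.TraceClass H,
        Φ X = (1 / 2 : ℂ) •
          (VirtualBroadcast.swap H * VirtualBroadcast.tensorOp 1 X.toOp +
            VirtualBroadcast.swap H * VirtualBroadcast.tensorOp X.toOp 1) := by
  constructor
  · rintro ⟨hcov, hperm, hcons⟩ X
    rw [VirtualBroadcast.eq_canonicalBroadcast e hcov hperm hcons,
      VirtualBroadcast.canonicalBroadcast_apply]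
  · intro h
    have hΦ : Φ = VirtualBroadcast.canonicalBroadcast H :=
      ContinuousLinearMap.ext fun X => (h X).trans
        (VirtualBroadcast.canonicalBroadcast_apply X).symm
    rw [hΦ]
    exact ⟨VirtualBroadcast.isUnitaryCovariant_canonicalBroadcast,
      VirtualBroadcast.isPermutationInvariant_canonicalBroadcast,
      VirtualBroadcast.isClassicallyConsistent_canonicalBroadcast e⟩
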